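/- Let $\mathcal H=\{z\in\mathbb C\mid \operatorname{Im} z>0\}$, $\log q=2\pi i z$, and let $E_2=1-24\sum_{n\ge1}\big(\sum_{d\mid n}d\big)e^{2\pi i nz}$ be the weight-$2$ Eisenstein series. For $k\in\mathbb R$ let $$D_kf=\frac{1}{2\pi i}\frac{df}{dz}-\frac{k}{12}E_2f ,\qquad D_k^{(0)}f=f,\qquad D_k^{(n)}=D_{k+2n-2}\cdots D_{k+2}D_k\quad(n\ge1).$$ A monic modular linear differential equation (monic MLDE) of weight $k$ is an equation $$D_k^{(n)}f+g_1D_k^{(n-1)}f+\cdots+g_{n-1}D_kf+g_nf=0$$ on $\mathcal H$, where $n\ge0$ and each $g_i$ is a holomorphic modular form of weight $2i$ on $\mathrm{SL}(2,\mathbb Z)$. Let $\Sigma_k$ be the set of all holomorphic functions $f:\mathcal H\to\mathbb C$ that satisfy some monic MLDE of weight $k$ (of some order $n$). Theorem. For all $k,l\in\mathbb R$: 1. $\Sigma_k\subset\Sigma_{k-1}$. 2. $(\log q)\,\Sigma_k\subset\Sigma_{k-1}$. 3. $E_2\,\Sigma_k\subset\Sigma_{k+1}$. 4. If $k-l\in\mathbb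 Z$, then $\Sigma_k+\Sigma_l\subset\Sigma_{\min\{k,l\}}$. -/

import Mathlib

open UpperHalfPlane
open scoped Manifold MatrixGroups ModularForm Pointwise

noncomputable section

/-- The iterated Ramanujan–Serre operator `D_{k+2n-2} ⋯ D_{k+2} D_k` (the identity for `n = 0`),
where `D_k f = (2πi)⁻¹ f' - (k/12) E₂ f` is Mathlib's `Derivative.serreDerivative k f`. -/
def srDiff (k : ℝ) (f : ℍ → ℂ) : ℕ → ℍ → ℂ
  | 0 => f
  | n + 1 => Derivative.serreDerivative ((k + 2 * n : ℝ) : ℂ) (srDiff k f n)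

/-- `f` satisfies some monic modular linear differential equation of weight `k`:
`∑_{i=0}^{n} g_i D_k^{(n-i)} f = 0` on the upper half plane, where `g_i` is a holomorphic modular
form of weight `2i` on `SL(2, ℤ)` and `g_0 = 1`. -/
def SatisfiesMonicMLDE (k : ℝ) (f : ℍ → ℂ) : Prop :=
  ∃ (n : ℕ) (g : ∀ i : ℕ, ModularForm 𝒮ℒ (2 * (i : ℤ))),
    (∀ z : ℍ, g 0 z = 1) ∧
    ∀ z : ℍ, ∑ i ∈ Finset.range (n + 1), g i z * srDiff k f (n - i) z = 0

/-- The set `Σ_k` of holomorphic functions on the upper half plane satisfying some monic MLDE of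
weight `k`. -/
def monicSol (k : ℝ) : Set (ℍ → ℂ) :=
  {f | MDiff f ∧ SatisfiesMonicMLDE k f}

/-- `log q = 2πi z`. -/
def logQ (z : ℍ) : ℂ := 2 * (Real.pi : ℂ) * Complex.I * (z : ℂ)

end

/-! Being a solution of a monic MLDE is an integrality condition. Let `X` record half the weight,
put f in degree 0 of `HoloFun[X]`, and let M be the ring of even-weight modular forms graded in the
same way. Then f is in Σ_k exactly when f lies in a finitely generated M-submodule stable under the
Serre derivative twisted by k. A monic equation provides such a module; conversely M = ℂ[E₄, E₆] is
Noetherian, so in such a module some iterated derivative depends on the earlier ones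
(`mem_monicSol_iff`). Finiteness passes to sums and, with twists adding, to products. If Dy is
constant, then D₁D₋₁y = (1/12)(DE₂ − E₂²/12)y, and the bracket is a modular form of weight 4. So 1
and log q are finite of twist −1, and so is E₂X = D₋₁(12). Multiplying by these three gives claims
1, 2 and 3; claim 4 follows from claim 1 and additivity. -/

/-! ### Finiteness under a twisted derivation -/

section TwistedDerivation

variable {K A : Type*} [Field K] [CommRing A] [Algebra K A]

/-- The derivation `δ` twisted by `-k e`. -/
def twistedDeriv (δ : Derivation K A A) (e : A) (k : K) : A →ₗ[K] A :=
  δ.toLinearMap - k • LinearMap.mulLeft K e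

variable {δ : Derivation K A A} {e : A}

lemma twistedDeriv_apply (k : K) (p : A) : twistedDeriv δ e k p = δ p - k • (e * p) := rfl

lemma twistedDeriv_mul (k l : K) (p q : A) :
    twistedDeriv δ e (k + l) (p * q) = twistedDeriv δ e k p * q + p * twistedDeriv δ e l q := by
  simp only [twistedDeriv_apply, Derivation.leibniz, smul_eq_mul, Algebra.smul_def, map_add]
  ring

/-- The element `p` lies in a finitely generated `S`-submodule stable under `δ - k e`. -/
def IsFiniteUnder (δ : Derivation K A A) (e : A) (S : Subalgebra K A) (k : K) (p : A) : Prop :=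
  ∃ N : Submodule S A, N.FG ∧ p ∈ N ∧ ∀ x ∈ N, twistedDeriv δ e k x ∈ N

variable {S : Subalgebra K A}

/-- Splitting the twist as 0 + k in the Leibniz rule puts only the untwisted δ on coefficients, and
δ preserves S; stability thus needs checking on generators only. -/
lemma twistedDeriv_mem_span (hS : ∀ s ∈ S, δ s ∈ S) {k : K} {t : Set A}
    (ht : ∀ x ∈ t, twistedDeriv δ e k x ∈ Submodule.span S t) :
    ∀ x ∈ Submodule.span S t, twistedDeriv δ e k x ∈ Submodule.span S t := by
  intro x hx
  induction hx using Submodule.span_induction with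
  | mem x hx => exact ht x hx
  | zero => simp
  | add x y _ _ hx hy => rw [map_add]; exact add_mem hx hy
  | smul s x hx ih =>
    have h : twistedDeriv δ e k (s • x) =
        (⟨δ s, hS s s.2⟩ : S) • x + s • twistedDeriv δ e k x := by
      rw [Subalgebra.smul_def, Subalgebra.smul_def, Subalgebra.smul_def, smul_eq_mul, smul_eq_mul,
        smul_eq_mul, ← zero_add k, twistedDeriv_mul, zero_add]
      simp [twistedDeriv_apply]
    rw [h]
    exact add_mem (Submodule.smul_mem _ _ hx) (Submodule.smul_mem _ _ ih)

lemma IsFiniteUnder.of_span (hS : ∀ s ∈ S, δ s ∈ S) {k : K} {t : Set A} (hfin : t.Finite)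
    (ht : ∀ x ∈ t, twistedDeriv δ e k x ∈ Submodule.span S t) {p : A}
    (hp : p ∈ Submodule.span S t) : IsFiniteUnder δ e S k p :=
  ⟨_, Submodule.fg_span hfin, hp, twistedDeriv_mem_span hS ht⟩

lemma IsFiniteUnder.add {k : K} {p q : A} (hp : IsFiniteUnder δ e S k p)
    (hq : IsFiniteUnder δ e S k q) : IsFiniteUnder δ e S k (p + q) := by
  obtain ⟨N, hN, hpN, hN'⟩ := hp
  obtain ⟨M, hM, hqM, hM'⟩ := hq
  refine ⟨N ⊔ M, hN.sup hM, Submodule.add_mem_sup hpN hqM, fun x hx ↦ ?_⟩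
  obtain ⟨y, hy, z, hz, rfl⟩ := Submodule.mem_sup.mp hx
  rw [map_add]
  exact Submodule.add_mem_sup (hN' y hy) (hM' z hz)

lemma IsFiniteUnder.mul {k l : K} {p q : A} (hp : IsFiniteUnder δ e S k p)
    (hq : IsFiniteUnder δ e S l q) : IsFiniteUnder δ e S (k + l) (p * q) := by
  obtain ⟨N, hN, hpN, hN'⟩ := hp
  obtain ⟨M, hM, hqM, hM'⟩ := hq
  refine ⟨N * M, hN.mul hM, Submodule.mul_mem_mul hpN hqM, fun x hx ↦ ?_⟩
  induction hx using Submodule.mul_induction_on' with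
  | mem_mul_mem y hy z hz =>
    rw [twistedDeriv_mul]
    exact add_mem (Submodule.mul_mem_mul (hN' y hy) hz) (Submodule.mul_mem_mul hy (hM' z hz))
  | add y _ z _ hy hz => rw [map_add]; exact add_mem hy hz

lemma IsFiniteUnder.pow_apply_mem {k : K} {N : Submodule S A} {p : A} (hp : p ∈ N)
    (hN : ∀ x ∈ N, twistedDeriv δ e k x ∈ N) (n : ℕ) : (twistedDeriv δ e k ^ n) p ∈ N := by
  induction n with
  | zero => simpa
  | succ n ih => rw [pow_succ']; exact hN _ ih

/-- Over a Noetherian ring of coefficients, an iterated derivative is a combination of the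
previous ones. -/
lemma IsFiniteUnder.exists_pow_mem_span [IsNoetherianRing S] {k : K} {p : A}
    (hp : IsFiniteUnder δ e S k p) : ∃ n : ℕ, (twistedDeriv δ e k ^ n) p ∈
      Submodule.span S ((fun m ↦ (twistedDeriv δ e k ^ m) p) '' (Finset.range n : Set ℕ)) := by
  obtain ⟨N, hN, hpN, hN'⟩ := hp
  have : IsNoetherian S N := isNoetherian_of_fg_of_noetherian N hN
  let v : ℕ → N := fun m ↦ ⟨(twistedDeriv δ e k ^ m) p, pow_apply_mem hpN hN' m⟩
  -- The ascending chain of spans of the first n derivatives stabilizes, which puts the n-th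
  -- derivative in the span of its predecessors.
  let F : ℕ →o Submodule S N :=
    ⟨fun n ↦ Submodule.span S (v '' (Finset.range n : Set ℕ)), fun a b hab ↦
      Submodule.span_mono (Set.image_mono (by simpa using hab))⟩
  obtain ⟨n, hn⟩ := monotone_stabilizes_iff_noetherian.mpr this F
  refine ⟨n, ?_⟩
  have h : v n ∈ F n := by
    rw [hn (n + 1) n.le_succ]
    exact Submodule.subset_span ⟨n, by simp, rfl⟩
  have h' := Submodule.mem_map_of_mem (f := N.subtype) h
  change _ ∈ Submodule.map N.subtype (Submodule.span S _) at h'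
  rw [Submodule.map_span, ← Set.image_comp] at h'
  exact h'

/-- An element `y` such that `(δ + e)² y` is an `S`-multiple of `y` generates, together with its
derivative, a stable module. -/
lemma isFiniteUnder_of_sq (hS : ∀ s ∈ S, δ s ∈ S) {k : K} {y u : A} (hu : u ∈ S)
    (hy : twistedDeriv δ e k (twistedDeriv δ e k y) = u * y) :
    IsFiniteUnder δ e S k y ∧ IsFiniteUnder δ e S k (twistedDeriv δ e k y) := by
  have ht : ∀ x ∈ ({y, twistedDeriv δ e k y} : Set A),
      twistedDeriv δ e k x ∈ Submodule.span S {y, twistedDeriv δ e k y} := by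
    rintro x (rfl | rfl)
    · exact Submodule.subset_span (by simp)
    · rw [hy]
      exact Submodule.smul_mem _ (⟨u, hu⟩ : S) (Submodule.subset_span (by simp))
  exact ⟨.of_span hS (Set.toFinite _) ht (Submodule.subset_span (by simp)),
    .of_span hS (Set.toFinite _) ht (Submodule.subset_span (by simp))⟩

end TwistedDerivation

/-! ### Serre derivatives, Ramanujan's form and division by the discriminant -/

section ModularForms

open ModularForm EisensteinSeries Derivative ModularFormClass

/-- A holomorphic function invariant under `SL(2, ℤ)` and bounded at `i∞` is a modular form. -/
def modularFormOfSlash {k : ℤ} (F : ℍ → ℂ) (hF : MDiff F) (hs : ∀ γ : SL(2, ℤ), F ∣[k] γ = F)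
    (hb : IsBoundedAtImInfty F) : ModularForm 𝒮ℒ k where
  toFun := F
  slash_action_eq' := fun _ ⟨γ, hγ⟩ ↦ hγ ▸ hs γ
  holo' := hF
  bdd_at_cusps' {c} hc := by
    rw [Subgroup.IsArithmetic.isCusp_iff_isCusp_SL2Z] at hc
    rw [OnePoint.isBoundedAt_iff_forall_SL2Z hc]
    intro γ _
    rwa [hs]

lemma ModularForm.slash_SL_eq {k : ℤ} (f : ModularForm 𝒮ℒ k) (γ : SL(2, ℤ)) :
    (f : ℍ → ℂ) ∣[k] γ = f :=
  f.slash_action_eq' _ ⟨γ, rfl⟩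

lemma ModularForm.isBoundedAtImInfty {k : ℤ} (f : ModularForm 𝒮ℒ k) :
    IsBoundedAtImInfty (f : ℍ → ℂ) := by
  simpa using ModularFormClass.bdd_at_infty_slash f (1 : SL(2, ℤ))

/-- Cauchy's estimate on discs of radius 1. The margin of 2 in the height keeps each disc inside ℍ
and in the region where F is bounded. -/
lemma UpperHalfPlane.IsBoundedAtImInfty.normalizedDeriv {F : ℍ → ℂ} (hF : MDiff F)
    (hb : IsBoundedAtImInfty F) : IsBoundedAtImInfty (normalizedDerivOfComplex F) := by
  rw [isBoundedAtImInfty_iff] at hb ⊢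
  obtain ⟨M, A, hMA⟩ := hb
  refine ⟨‖(2 * Real.pi * Complex.I : ℂ)⁻¹‖ * (M / 1), max A 0 + 2, fun z hz ↦ ?_⟩
  have him : ∀ w ∈ Metric.closedBall (z : ℂ) 1, max A 0 + 1 ≤ w.im := by
    intro w hw
    have h1 : |(w - z).im| ≤ 1 :=
      (Complex.abs_im_le_norm _).trans (by simpa [dist_eq_norm] using hw)
    have h2 := (abs_le.mp h1).1
    have h3 : (z : ℂ).im = z.im := rfl
    rw [Complex.sub_im] at h2
    linarith
  rw [normalizedDerivOfComplex, norm_mul]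
  refine mul_le_mul_of_nonneg_left ?_ (norm_nonneg _)
  rw [UpperHalfPlane.mdifferentiable_iff] at hF
  refine Complex.norm_deriv_le_of_forall_mem_sphere_norm_le one_pos
    (DifferentiableOn.diffContOnCl (hF.mono fun w hw ↦ ?_)) fun w hw ↦ ?_
  · rw [closure_ball _ one_ne_zero] at hw
    exact lt_of_lt_of_le (by positivity) (him w hw)
  · have hw' := him w (Metric.sphere_subset_closedBall hw)
    have hw0 : 0 < w.im := lt_of_lt_of_le (by positivity) hw'
    rw [Function.comp_apply, ofComplex_apply_of_im_pos hw0]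
    exact hMA _ (le_trans (by linarith [le_max_left A 0]) hw')

/-- The Serre derivative of a modular form, as a modular form. -/
noncomputable def ModularForm.serreDeriv {k : ℤ} (f : ModularForm 𝒮ℒ k) : ModularForm 𝒮ℒ (k + 2) :=
  modularFormOfSlash (serreDerivative k f) (serreDerivative_mdifferentiable _ f.holo')
    (fun γ ↦ serreDerivative_slash_invariant f.holo' (f.slash_SL_eq γ)) <| by
      have h := (f.isBoundedAtImInfty.normalizedDeriv f.holo').sub
        ((isBoundedAtImInfty_E2.mul f.isBoundedAtImInfty).const_mul_left ((k : ℂ) * 12⁻¹))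
      refine h.congr_left fun z ↦ ?_
      simp [mul_assoc]

lemma D2_mdifferentiable (γ : SL(2, ℤ)) : MDiff (D2 γ) := by
  rw [UpperHalfPlane.mdifferentiable_iff]
  intro w hw
  have h := (hasDerivAt_denom_zpow (γ : GL (Fin 2) ℝ) (-1) ⟨w, hw⟩).const_mul
    (2 * Real.pi * Complex.I * γ 1 0)
  refine (h.congr_of_eventuallyEq ?_).differentiableAt.differentiableWithinAt
  filter_upwards [isOpen_upperHalfPlaneSet.mem_nhds hw] with v hv
  simp [D2, ofComplex_apply_of_im_pos hv, div_eq_mul_inv]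

lemma normalizedDeriv_D2 (γ : SL(2, ℤ)) (z : ℍ) :
    normalizedDerivOfComplex (D2 γ) z = -((2 * Real.pi * Complex.I)⁻¹ * D2 γ z) ^ 2 := by
  have h := (hasDerivAt_denom_zpow (γ : GL (Fin 2) ℝ) (-1) z).const_mul
    (2 * Real.pi * Complex.I * γ 1 0)
  have h' : HasDerivAt (D2 γ ∘ ofComplex) _ (z : ℂ) := h.congr_of_eventuallyEq (by
    filter_upwards [isOpen_upperHalfPlaneSet.mem_nhds z.im_pos] with v hv
    simp [D2, ofComplex_apply_of_im_pos hv, div_eq_mul_inv])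
  have hz := denom_ne_zero γ z
  have hpi : (2 * Real.pi * Complex.I : ℂ) ≠ 0 := by simp [Real.pi_ne_zero]
  rw [normalizedDerivOfComplex, h'.deriv, D2]
  have h2 : (denom γ z) ^ (-1 - 1 : ℤ) = ((denom γ z) ^ 2)⁻¹ := by
    rw [show (-1 - 1 : ℤ) = -(2 : ℕ) by norm_num, zpow_neg, zpow_natCast]
  rw [h2]
  simp
  field_simp
  simp [Complex.I_sq]

/-- `D E₂ - E₂² / 12` as a modular form of weight `4`. -/
noncomputable def ramanujanForm : ModularForm 𝒮ℒ 4 :=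
  modularFormOfSlash (normalizedDerivOfComplex E2 - (12⁻¹ : ℂ) • (E2 * E2))
    ((normalizedDerivOfComplex_mdifferentiable E2_mdifferentiable).sub
      ((E2_mdifferentiable.mul E2_mdifferentiable).const_smul _))
    (fun γ ↦ by
      have h1 := normalizedDerivOfComplex_SL_slash (k := 2) (γ := γ) E2_mdifferentiable
      have h2 := mul_slash_SL2 2 2 γ E2 E2
      norm_num only at h1 h2
      rw [E2_slash_action] at h1 h2
      rw [normalizedDerivOfComplex_sub _ _ E2_mdifferentiable
        ((D2_mdifferentiable γ).const_smul _), normalizedDerivOfComplex_smul _ _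
        (D2_mdifferentiable γ)] at h1
      rw [sub_eq_add_neg, SlashAction.add_slash, SlashAction.neg_slash, ModularForm.SL_smul_slash,
        h2]
      ext z
      have h3 := congrFun h1 z
      have hz := denom_ne_zero γ z
      have hpi : (Real.pi : ℂ) ≠ 0 := by simp [Real.pi_ne_zero]
      simp only [Pi.sub_apply, Pi.smul_apply, smul_eq_mul, normalizedDeriv_D2, Pi.add_apply,
        Pi.neg_apply, Pi.mul_apply, D2, riemannZeta_two] at h3 ⊢
      -- With u = (2πi)⁻¹c/(cz+d), the action sends E₂ to E₂ + 12u, and Du = −u². Both DE₂ and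
      -- E₂²/12 then pick up the same error 2uE₂ + 12u², which cancels.
      have e1 : 1 / (2 * ((Real.pi : ℂ) ^ 2 / 6)) *
          (2 * Real.pi * Complex.I * (γ 1 0 : ℂ) / denom γ z) =
            -12 * ((2 * Real.pi * Complex.I)⁻¹ * ((γ 1 0 : ℂ) / denom γ z)) := by
        field_simp
        rw [Complex.I_sq]
        ring
      have e2 : 1 / (2 * ((Real.pi : ℂ) ^ 2 / 6)) * -((2 * Real.pi * Complex.I)⁻¹ *
          (2 * Real.pi * Complex.I * (γ 1 0 : ℂ) / denom γ z)) ^ 2 =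
            12 * ((2 * Real.pi * Complex.I)⁻¹ * ((γ 1 0 : ℂ) / denom γ z)) ^ 2 := by
        field_simp
        rw [Complex.I_sq]
        ring
      rw [e1, e2] at h3
      rw [e1]
      linear_combination -h3)
    ((isBoundedAtImInfty_E2.normalizedDeriv E2_mdifferentiable).sub
      ((isBoundedAtImInfty_E2.mul isBoundedAtImInfty_E2).const_smul_left _))

/-- E₄ᵃE₆ᵇ has constant term 1, so subtracting a multiple of it leaves a cusp form, which is
divisible by Δ = (E₄³ − E₆²)/1728. -/
theorem ModularForm.exists_eq_smul_add_discriminant_mul {i : ℕ} (hi : 2 ≤ i)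
    (f : ModularForm 𝒮ℒ (2 * (i : ℤ))) : ∃ (a b : ℕ) (c : ℂ)
    (g : ModularForm 𝒮ℒ (2 * (i : ℤ) - 12)), i = 2 * a + 3 * b ∧
      (f : ℍ → ℂ) = c • ((E₄ : ℍ → ℂ) ^ a * (E₆ : ℍ → ℂ) ^ b) +
        (1728⁻¹ : ℂ) • (((E₄ : ℍ → ℂ) ^ 3 - (E₆ : ℍ → ℂ) ^ 2) * g) := by
  obtain ⟨a, b, hab⟩ : ∃ a b, i = 2 * a + 3 * b := by
    rcases Nat.even_or_odd' i with ⟨m, rfl | rfl⟩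
    · exact ⟨m, 0, by ring⟩
    · exact ⟨m - 1, 1, by omega⟩
  let P : ModularForm 𝒮ℒ (2 * (i : ℤ)) := ((E₄.pow a).mul (E₆.pow b)).mcast (by
    subst hab; push_cast; ring)
  have hP : (P : ℍ → ℂ) = (E₄ : ℍ → ℂ) ^ a * (E₆ : ℍ → ℂ) ^ b := by
    simp [P, ModularForm.coe_mcast]
  have hP1 : (qExpansion 1 P).coeff 0 = 1 := by
    have : qExpansion 1 P = qExpansion 1 E₄ ^ a * qExpansion 1 E₆ ^ b := by
      rw [← ModularForm.qExpansion_pow one_pos one_mem_strictPeriods_SL,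
        ← ModularForm.qExpansion_pow one_pos one_mem_strictPeriods_SL,
        ← ModularForm.qExpansion_mul one_pos one_mem_strictPeriods_SL]
      rfl
    have h4 := E_qExpansion_coeff_zero (by norm_num : 3 ≤ 4) ⟨2, rfl⟩
    have h6 := E_qExpansion_coeff_zero (by norm_num : 3 ≤ 6) ⟨3, rfl⟩
    rw [PowerSeries.coeff_zero_eq_constantCoeff_apply] at h4 h6 ⊢
    rw [this, map_mul, map_pow, map_pow, h4, h6]
    simp
  let c : ℂ := (qExpansion 1 f).coeff 0
  have hc : (qExpansion 1 (f - c • P : ModularForm 𝒮ℒ (2 * (i : ℤ)))).coeff 0 = 0 := by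
    rw [FunLike.coe_sub, ModularForm.qExpansion_sub one_pos one_mem_strictPeriods_SL,
      FunLike.coe_smul, ModularForm.qExpansion_smul one_pos one_mem_strictPeriods_SL, map_sub,
      PowerSeries.coeff_smul, hP1]
    simp [c]
  have h := discriminant_mul_discriminantEquiv (toCuspForm _ hc)
  refine ⟨a, b, c, CuspForm.discriminantEquiv (toCuspForm _ hc), hab, ?_⟩
  ext z
  have hz := congrFun h z
  have hfz : (toCuspForm _ hc) z = f z - c * P z := rfl
  have hPz := congrFun hP z
  simp only [Pi.mul_apply, discriminant_eq_E₄_cube_sub_E₆_sq, hfz, hPz, Pi.pow_apply] at hz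
  simp only [Pi.add_apply, Pi.smul_apply, Pi.mul_apply, Pi.sub_apply, Pi.pow_apply, smul_eq_mul]
  linear_combination -hz

end ModularForms

/-! ### The graded algebra of holomorphic functions and the Noetherian ring of modular forms -/

section GradedFunctions

open ModularForm EisensteinSeries Derivative Polynomial

/-- The algebra of holomorphic functions on the upper half plane. -/
def holoAlg : Subalgebra ℂ (ℍ → ℂ) where
  carrier := {f | MDiff f}
  mul_mem' hf hg := hf.mul hg
  add_mem' hf hg := hf.add hg
  algebraMap_mem' _ := mdifferentiable_const

/-- The type of holomorphic functions on the upper half plane. -/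
def HoloFun : Type := holoAlg

namespace HoloFun

noncomputable instance : CommRing HoloFun := inferInstanceAs (CommRing holoAlg)

noncomputable instance : Algebra ℂ HoloFun := inferInstanceAs (Algebra ℂ holoAlg)

/-- The underlying function of a holomorphic function. -/
def val : HoloFun →ₐ[ℂ] (ℍ → ℂ) := holoAlg.val

/-- Bundle a holomorphic function as an element of `HoloFun`. -/
def mk (f : ℍ → ℂ) (hf : MDiff f) : HoloFun := ⟨f, hf⟩

@[simp] lemma val_mk (f : ℍ → ℂ) (hf : MDiff f) : val (mk f hf) = f := rfl

lemma mdiff (f : HoloFun) : MDiff (val f) := Subtype.property (p := fun g ↦ g ∈ holoAlg) f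

lemma val_injective : Function.Injective val := Subtype.val_injective

end HoloFun

open HoloFun

/-- The derivation `(2πi)⁻¹ d/dz` of the algebra of holomorphic functions. -/
noncomputable def holoDeriv : Derivation ℂ HoloFun HoloFun :=
  Derivation.mk'
    { toFun := fun f ↦ .mk (normalizedDerivOfComplex (val f))
        (normalizedDerivOfComplex_mdifferentiable f.mdiff)
      map_add' := fun f g ↦ val_injective <| by
        simp [normalizedDerivOfComplex_add _ _ f.mdiff g.mdiff]
      map_smul' := fun c f ↦ val_injective <| by
        simp [normalizedDerivOfComplex_smul c _ f.mdiff] }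
    fun f g ↦ val_injective <| by
      change normalizedDerivOfComplex (val (f * g)) = val (f * _ + g * _)
      rw [map_mul, normalizedDerivOfComplex_mul _ _ f.mdiff g.mdiff, map_add, map_mul, map_mul]
      simp
      ring

lemma val_holoDeriv (f : HoloFun) : val (holoDeriv f) = normalizedDerivOfComplex (val f) := rfl

/-- `E₂` as an element of the algebra of holomorphic functions. -/
noncomputable def holoE2 : HoloFun := .mk E2 E2_mdifferentiable

/-- The Serre derivative on the algebra of holomorphic functions. -/
noncomputable def holoSerre (k : ℂ) (f : HoloFun) : HoloFun :=
  holoDeriv f - (k * 12⁻¹) • (holoE2 * f)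

lemma val_holoSerre (k : ℂ) (f : HoloFun) : val (holoSerre k f) = serreDerivative k (val f) := by
  ext z
  simp [holoSerre, val_holoDeriv, holoE2]
  ring

/-- On `HoloFun[X]`, where `X` records half the weight, the derivation acting as the Serre
derivative of weight `2n` on the coefficient of `X ^ n`. -/
noncomputable def gradedSerre : Derivation ℂ HoloFun[X] HoloFun[X] :=
  -- This is X·D − (E₂/6)X²·d/dX: differentiating Xⁿ supplies the factor n, hence the required
  -- 2n/12.
  (X : HoloFun[X]) • PolynomialModule.equivPolynomialSelf.compDer holoDeriv.mapCoeffs -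
    (monomial 2 ((6⁻¹ : ℂ) • holoE2)) • Polynomial.derivative'.restrictScalars ℂ

/-- `E₂ / 12` in degree one. -/
noncomputable def gradedE2 : HoloFun[X] := monomial 1 ((12⁻¹ : ℂ) • holoE2)

lemma gradedSerre_monomial (n : ℕ) (f : HoloFun) :
    gradedSerre (monomial n f) = monomial (n + 1) (holoSerre (2 * n) f) := by
  have h : gradedSerre (monomial n f) = X * PolynomialModule.equivPolynomialSelf
      (holoDeriv.mapCoeffs (monomial n f)) -
      monomial 2 ((6⁻¹ : ℂ) • holoE2) * derivative (monomial n f) := rfl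
  rw [h, Derivation.mapCoeffs_monomial]
  simp only [PolynomialModule.equivPolynomialSelf_apply_eq,
    PolynomialModule.equivPolynomial_single, derivative_monomial]
  cases n with
  | zero => simp [holoSerre, X_mul_C, ← C_mul_X_eq_monomial]
  | succ n =>
    rw [X_mul_monomial, monomial_mul_monomial, show 2 + (n + 1 - 1) = n + 1 + 1 by lia,
      ← LinearMap.map_sub, holoSerre]
    congr 2
    apply val_injective
    ext z
    simp
    ring

lemma twistedDeriv_monomial (k : ℂ) (n : ℕ) (f : HoloFun) :
    twistedDeriv gradedSerre gradedE2 k (monomial n f) =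
      monomial (n + 1) (holoSerre (k + 2 * n) f) := by
  rw [twistedDeriv_apply, gradedSerre_monomial, gradedE2, monomial_mul_monomial, smul_monomial,
    add_comm 1 n, ← map_sub, holoSerre, holoSerre, sub_sub, smul_mul_assoc, smul_smul, ← add_smul]
  congr 4
  ring

/-- The functions on the upper half plane which are modular forms of weight `k`. -/
def modularFunctions (k : ℤ) : Submodule ℂ (ℍ → ℂ) where
  carrier := {f | ∃ g : ModularForm 𝒮ℒ k, (g : ℍ → ℂ) = f}
  add_mem' := by rintro _ _ ⟨f, rfl⟩ ⟨g, rfl⟩; exact ⟨f + g, rfl⟩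
  zero_mem' := ⟨0, rfl⟩
  smul_mem' := by rintro c _ ⟨f, rfl⟩; exact ⟨c • f, rfl⟩

lemma mul_mem_modularFunctions {k l m : ℤ} (h : k + l = m) {f g : ℍ → ℂ}
    (hf : f ∈ modularFunctions k) (hg : g ∈ modularFunctions l) :
    f * g ∈ modularFunctions m := by
  obtain ⟨f, rfl⟩ := hf
  obtain ⟨g, rfl⟩ := hg
  exact ⟨(f.mul g).mcast h, rfl⟩

/-- The ring of modular forms of even weight as a subalgebra of `HoloFun[X]`. -/
def modularAlg : Subalgebra ℂ HoloFun[X] where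
  carrier := {p | ∀ i : ℕ, val (p.coeff i) ∈ modularFunctions (2 * (i : ℤ))}
  add_mem' hp hq i := by
    rw [coeff_add, map_add]
    exact add_mem (hp i) (hq i)
  mul_mem' hp hq i := by
    rw [coeff_mul, map_sum]
    refine sum_mem fun x hx ↦ ?_
    rw [map_mul]
    refine mul_mem_modularFunctions ?_ (hp x.1) (hq x.2)
    rw [← Finset.HasAntidiagonal.mem_antidiagonal.mp hx]
    push_cast
    ring
  algebraMap_mem' c i := by
    rw [Polynomial.algebraMap_apply, coeff_C]
    split_ifs with h
    · subst h
      exact ⟨(ModularForm.const c).mcast (by simp), by rw [AlgHom.commutes]; rfl⟩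
    · simp

lemma mem_modularAlg {p : HoloFun[X]} :
    p ∈ modularAlg ↔ ∀ i : ℕ, val (p.coeff i) ∈ modularFunctions (2 * (i : ℤ)) := Iff.rfl

lemma monomial_mem_modularAlg {n : ℕ} {f : HoloFun}
    (hf : val f ∈ modularFunctions (2 * (n : ℤ))) : monomial n f ∈ modularAlg := by
  intro i
  rw [coeff_monomial]
  split_ifs with h
  · exact h ▸ hf
  · simp

lemma gradedSerre_mem_modularAlg {p : HoloFun[X]} (hp : p ∈ modularAlg) :
    gradedSerre p ∈ modularAlg := by
  rw [p.as_sum_range, map_sum]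
  refine sum_mem fun i _ ↦ ?_
  rw [gradedSerre_monomial]
  refine monomial_mem_modularAlg ?_
  obtain ⟨g, hg⟩ := hp i
  rw [val_holoSerre, ← hg]
  refine ⟨g.serreDeriv.mcast (by push_cast; ring), ?_⟩
  change serreDerivative ((2 * (i : ℤ) : ℤ) : ℂ) g = _
  push_cast
  rfl

/-- A modular form as a holomorphic function. -/
def ModularForm.toHolo {k : ℤ} (f : ModularForm 𝒮ℒ k) : HoloFun := .mk f f.holo'

/-- Strong induction on half the weight: dividing by Δ lowers it by 6. This makes the ring finitely
generated over ℂ, hence Noetherian. -/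
lemma modularAlg_eq_adjoin :
    modularAlg = Algebra.adjoin ℂ {monomial 2 E₄.toHolo, monomial 3 E₆.toHolo} := by
  refine le_antisymm (fun p hp ↦ ?_) (Algebra.adjoin_le ?_)
  · rw [p.as_sum_range]
    refine sum_mem fun i _ ↦ ?_
    have key : ∀ (n : ℕ) (g : ModularForm 𝒮ℒ (2 * (n : ℤ))), monomial n g.toHolo ∈
        Algebra.adjoin ℂ {monomial 2 E₄.toHolo, monomial 3 E₆.toHolo} := by
      intro n
      induction n using Nat.strong_induction_on with
      | _ n ih =>
        intro g
        rcases Nat.lt_or_ge n 2 with hn | hn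
        · interval_cases n
          · obtain ⟨c, hc⟩ := ModularFormClass.levelOne_weight_zero_const (F := ModularForm 𝒮ℒ 0) (g.mcast (by simp))
            have : monomial 0 g.toHolo = algebraMap ℂ HoloFun[X] c := by
              rw [Polynomial.algebraMap_apply, ← monomial_zero_left]
              congr 1
              apply val_injective
              rw [AlgHom.commutes]
              exact hc
            rw [this]
            exact Subalgebra.algebraMap_mem _ c
          · have h0 : g = 0 :=
              rank_zero_iff_forall_zero.mp levelOne_weight_two_rank_zero g
            have : g.toHolo = 0 := val_injective (by rw [h0, map_zero]; rfl)
            rw [this, map_zero]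
            exact zero_mem _
        · obtain ⟨a, b, c, h, hab, hg⟩ := exists_eq_smul_add_discriminant_mul hn g
          have h4 := Algebra.subset_adjoin (R := ℂ)
            (Set.mem_insert (monomial 2 E₄.toHolo) {monomial 3 E₆.toHolo})
          have h6 := Algebra.subset_adjoin (R := ℂ)
            (Set.mem_insert_of_mem (monomial 2 E₄.toHolo) (Set.mem_singleton (monomial 3 E₆.toHolo)))
          have hmain := Subalgebra.smul_mem _ (mul_mem (pow_mem h4 a) (pow_mem h6 b)) c
          rcases Nat.lt_or_ge n 6 with hn6 | hn6
          -- Below weight 12 the cofactor of Δ has negative weight, so it vanishes.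
          · have h0 : (h : ℍ → ℂ) = 0 := ModularFormClass.levelOne_neg_weight_eq_zero (by lia) h
            have : monomial n g.toHolo =
                c • (monomial 2 E₄.toHolo ^ a * monomial 3 E₆.toHolo ^ b) := by
              rw [monomial_pow, monomial_pow, monomial_mul_monomial, smul_monomial, ← hab]
              congr 1
              apply val_injective
              simp only [map_smul, map_mul, map_pow]
              exact hg.trans (by rw [h0, mul_zero, smul_zero, add_zero]; rfl)
            rw [this]
            exact hmain
          · obtain ⟨m, rfl⟩ := Nat.exists_eq_add_of_le' hn6
            have h' := ih m (by lia) (h.mcast (by push_cast; ring))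
            have : monomial (m + 6) g.toHolo =
                c • (monomial 2 E₄.toHolo ^ a * monomial 3 E₆.toHolo ^ b) +
                (1728⁻¹ : ℂ) • ((monomial 2 E₄.toHolo ^ 3 - monomial 3 E₆.toHolo ^ 2) *
                  monomial m (ModularForm.toHolo (h.mcast (by push_cast; ring) :
                    ModularForm 𝒮ℒ (2 * (m : ℤ))))) := by
              rw [monomial_pow, monomial_pow, monomial_pow, monomial_pow, monomial_mul_monomial,
                ← hab, ← LinearMap.map_sub, monomial_mul_monomial, smul_monomial, smul_monomial,
                show 2 * 3 + m = m + 6 by ring, ← LinearMap.map_add]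
              congr 1
              apply val_injective
              simp only [map_smul, map_mul, map_pow, map_add, map_sub]
              exact hg
            rw [this]
            exact add_mem hmain (Subalgebra.smul_mem _
              (mul_mem (sub_mem (pow_mem h4 3) (pow_mem h6 2)) h') _)
    obtain ⟨g, hg⟩ := hp i
    have : p.coeff i = g.toHolo := val_injective hg.symm
    rw [this]
    exact key i g
  · rintro _ (rfl | rfl)
    · exact monomial_mem_modularAlg ⟨E₄, rfl⟩
    · exact monomial_mem_modularAlg ⟨E₆, rfl⟩

instance : IsNoetherianRing modularAlg := by
  have : Algebra.FiniteType ℂ modularAlg := by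
    rw [← Subalgebra.fg_iff_finiteType, modularAlg_eq_adjoin]
    exact Subalgebra.fg_def.mpr ⟨_, Set.toFinite _, rfl⟩
  exact Algebra.FiniteType.isNoetherianRing ℂ modularAlg

end GradedFunctions

/-! ### Monic MLDEs as a finiteness condition -/

section MonicMLDE

open ModularForm EisensteinSeries Derivative Polynomial HoloFun

lemma srDiff_mdifferentiable (k : ℝ) {f : ℍ → ℂ} (hf : MDiff f) (n : ℕ) : MDiff (srDiff k f n) := by
  induction n with
  | zero => exact hf
  | succ n ih => exact serreDerivative_mdifferentiable _ ih

/-- The iterated Ramanujan–Serre operator on holomorphic functions. -/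
noncomputable def holoSrDiff (k : ℝ) (f : HoloFun) (n : ℕ) : HoloFun :=
  .mk (srDiff k (val f) n) (srDiff_mdifferentiable k f.mdiff n)

lemma holoSrDiff_zero (k : ℝ) (f : HoloFun) : holoSrDiff k f 0 = f := rfl

lemma holoSrDiff_succ (k : ℝ) (f : HoloFun) (n : ℕ) :
    holoSrDiff k f (n + 1) = holoSerre ((k + 2 * n : ℝ) : ℂ) (holoSrDiff k f n) :=
  val_injective (val_holoSerre _ (holoSrDiff k f n)).symm

/-- Multiplication by `X ^ a` shifts the weight by `2a`. -/
lemma twistedDeriv_pow_monomial {k : ℝ} {l : ℂ} {a : ℕ} (hk : l + 2 * a = k) (f : HoloFun) (n : ℕ) :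
    (twistedDeriv gradedSerre gradedE2 l ^ n) (monomial a f) =
      monomial (n + a) (holoSrDiff k f n) := by
  induction n with
  | zero => simp [holoSrDiff_zero]
  | succ n ih =>
    rw [pow_succ', Module.End.mul_apply, ih, twistedDeriv_monomial, holoSrDiff_succ]
    congr 2
    · ring
    · push_cast
      rw [← hk]
      ring

lemma satisfiesMonicMLDE_of_isFiniteUnder {k : ℝ} {l : ℂ} {a : ℕ} (hk : l + 2 * a = k)
    {f : HoloFun} (h : IsFiniteUnder gradedSerre gradedE2 modularAlg l (monomial a f)) :
    SatisfiesMonicMLDE k (val f) := by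
  obtain ⟨n, hn⟩ := h.exists_pow_mem_span
  obtain ⟨c₀, hc₀⟩ := (Submodule.mem_span_image_finset_iff_exists_fun _).mp hn
  obtain ⟨c, hc⟩ : ∃ c : ℕ → modularAlg, ∑ m ∈ Finset.range n,
      c m • (twistedDeriv gradedSerre gradedE2 l ^ m) (monomial a f) =
        (twistedDeriv gradedSerre gradedE2 l ^ n) (monomial a f) := by
    refine ⟨fun m ↦ if h : m ∈ Finset.range n then c₀ ⟨m, h⟩ else 0, ?_⟩
    rw [← hc₀, ← Finset.sum_coe_sort]
    refine Finset.sum_congr rfl fun m _ ↦ ?_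
    beta_reduce
    rw [dif_pos m.2]
  -- The coefficients `c m` need not be homogeneous. Comparing degree n + a keeps only their
  -- components of degree n − m, which are forms of weight 2(n − m).
  have hcoeff : ∑ m ∈ Finset.range n, (c m : HoloFun[X]).coeff (n - m) * holoSrDiff k f m =
      holoSrDiff k f n := by
    have := congrArg (fun p ↦ p.coeff (n + a)) hc
    simp only [twistedDeriv_pow_monomial hk, coeff_monomial_same, finsetSum_coeff,
      Subalgebra.smul_def, smul_eq_mul] at this
    rw [← this]
    refine Finset.sum_congr rfl fun m hm ↦ ?_
    have hm' : m < n := Finset.mem_range.mp hm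
    rw [show n + a = (n - m) + (m + a) by lia, coeff_mul_monomial]
  choose g hg using fun m : ℕ ↦ mem_modularAlg.mp (c m).2
  refine ⟨n, fun i ↦ match i with
    | 0 => (1 : ModularForm 𝒮ℒ 0).mcast (by simp)
    | i + 1 => -g (n - (i + 1)) (i + 1), fun _ ↦ rfl, fun z ↦ ?_⟩
  have hz := congrFun (congrArg val hcoeff) z
  simp only [map_sum, map_mul, Finset.sum_apply, Pi.mul_apply, holoSrDiff, val_mk] at hz
  rw [← Finset.sum_range_reflect] at hz
  rw [Finset.sum_range_succ', Nat.sub_zero, ← hz]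
  change _ + 1 * _ = (0 : ℂ)
  rw [one_mul, ← Finset.sum_add_distrib]
  refine Finset.sum_eq_zero fun i hi ↦ ?_
  have hi' : i < n := Finset.mem_range.mp hi
  change -(g (n - (i + 1)) (i + 1) z) * _ + _ = (0 : ℂ)
  rw [hg, show n - 1 - i = n - (i + 1) by lia, show n - (n - (i + 1)) = i + 1 by lia]
  ring

lemma SatisfiesMonicMLDE.isFiniteUnder {k : ℝ} {f : HoloFun} (h : SatisfiesMonicMLDE k (val f)) :
    IsFiniteUnder gradedSerre gradedE2 modularAlg (k : ℂ) (C f) := by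
  obtain ⟨n, g, hg0, hg⟩ := h
  have hpow := twistedDeriv_pow_monomial (k := k) (l := k) (a := 0) (by simp) f
  simp only [add_zero, monomial_zero_left] at hpow
  let v : ℕ → HoloFun[X] := fun m ↦ monomial m (holoSrDiff k f m)
  let t : Set HoloFun[X] := v '' (Finset.range n : Set ℕ)
  have hlt : ∀ m < n, v m ∈ Submodule.span modularAlg t := fun m hm ↦
    Submodule.subset_span ⟨m, by simpa using hm, rfl⟩
  have hn : v n ∈ Submodule.span modularAlg t := by
    have hrel : v n = -∑ i ∈ Finset.range n, monomial (i + 1) (g (i + 1)).toHolo *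
        v (n - (i + 1)) := by
      have h1 : ∑ i ∈ Finset.range n, monomial (i + 1) (g (i + 1)).toHolo * v (n - (i + 1)) =
          monomial n (∑ i ∈ Finset.range n, (g (i + 1)).toHolo * holoSrDiff k f (n - (i + 1))) := by
        rw [map_sum]
        refine Finset.sum_congr rfl fun i hi ↦ ?_
        have hi' : i < n := Finset.mem_range.mp hi
        rw [monomial_mul_monomial]
        congr 2
        lia
      rw [h1, ← LinearMap.map_neg]
      refine congrArg (monomial n) ?_
      apply val_injective
      ext z
      have hz := hg z
      rw [Finset.sum_range_succ', hg0, one_mul, Nat.sub_zero] at hz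
      simp only [map_neg, map_sum, map_mul, Pi.neg_apply, Finset.sum_apply, Pi.mul_apply,
        holoSrDiff, val_mk]
      exact eq_neg_of_add_eq_zero_right hz
    rw [hrel]
    refine neg_mem (sum_mem fun i hi ↦ ?_)
    have hi' : i < n := Finset.mem_range.mp hi
    exact Submodule.smul_mem _ (⟨_, monomial_mem_modularAlg ⟨g (i + 1), rfl⟩⟩ : modularAlg)
      (hlt _ (by lia))
  -- Including m = n also covers order 0, where t is empty and `hn` places f itself in the span.
  have hle : ∀ m ≤ n, v m ∈ Submodule.span modularAlg t := fun m hm ↦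
    (Nat.lt_or_eq_of_le hm).elim (hlt m) (fun h ↦ h ▸ hn)
  refine .of_span (fun s hs ↦ gradedSerre_mem_modularAlg hs) ((Finset.finite_toSet _).image v) ?_
    (hle 0 n.zero_le)
  rintro _ ⟨m, hm, rfl⟩
  have : twistedDeriv gradedSerre gradedE2 (k : ℂ) (v m) = v (m + 1) := by
    change _ = monomial (m + 1) (holoSrDiff k f (m + 1))
    rw [← hpow, pow_succ', Module.End.mul_apply, hpow]
  rw [this]
  exact hle _ (by simpa using hm)

lemma mem_monicSol_iff {k : ℝ} {f : HoloFun} :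
    val f ∈ monicSol k ↔ IsFiniteUnder gradedSerre gradedE2 modularAlg (k : ℂ) (C f) :=
  ⟨fun h ↦ h.2.isFiniteUnder, fun h ↦
    ⟨f.mdiff, satisfiesMonicMLDE_of_isFiniteUnder (a := 0) (by simp) h⟩⟩

lemma exists_holoFun_of_mem_monicSol {k : ℝ} {f : ℍ → ℂ} (hf : f ∈ monicSol k) :
    ∃ F : HoloFun, val F = f := ⟨.mk f hf.1, rfl⟩

/-! ### Multiplication by 1, log q and E₂ -/

/-- Functions with constant normalized derivative satisfy the second-order equation of weight
`-1` given by `D E₂ - E₂² / 12`. -/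
lemma twistedDeriv_sq_of_const {y : HoloFun} {c : ℂ} (hy : holoDeriv y = algebraMap ℂ HoloFun c) :
    twistedDeriv gradedSerre gradedE2 (-1) (twistedDeriv gradedSerre gradedE2 (-1) (C y)) =
      monomial 2 ((12⁻¹ : ℂ) • ramanujanForm.toHolo) * C y := by
  rw [← monomial_zero_left, twistedDeriv_monomial, twistedDeriv_monomial, monomial_mul_monomial]
  congr 1
  have hr : ramanujanForm.toHolo = holoDeriv holoE2 - (12⁻¹ : ℂ) • (holoE2 * holoE2) := rfl
  simp only [holoSerre, hr, map_sub, hy, Derivation.map_smul, Derivation.leibniz,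
    Derivation.map_algebraMap, smul_eq_mul]
  apply val_injective
  ext z
  simp
  ring

lemma isFiniteUnder_of_const {y : HoloFun} {c : ℂ} (hy : holoDeriv y = algebraMap ℂ HoloFun c) :
    IsFiniteUnder gradedSerre gradedE2 modularAlg (-1 : ℂ) (C y) ∧
    IsFiniteUnder gradedSerre gradedE2 modularAlg (-1 : ℂ)
      (twistedDeriv gradedSerre gradedE2 (-1) (C y)) :=
  isFiniteUnder_of_sq (fun s hs ↦ gradedSerre_mem_modularAlg hs)
    (monomial_mem_modularAlg (by
      rw [map_smul]
      exact Submodule.smul_mem _ _ ⟨ramanujanForm, rfl⟩))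
    (twistedDeriv_sq_of_const hy)

lemma mul_mem_monicSol_of_const {y : HoloFun} {c : ℂ} (hy : holoDeriv y = algebraMap ℂ HoloFun c)
    {k : ℝ} {f : ℍ → ℂ} (hf : f ∈ monicSol k) : val y * f ∈ monicSol (k - 1) := by
  obtain ⟨F, rfl⟩ := exists_holoFun_of_mem_monicSol hf
  rw [← map_mul, mem_monicSol_iff, C_mul]
  have := (isFiniteUnder_of_const hy).1.mul (mem_monicSol_iff.mp hf)
  push_cast
  rwa [sub_eq_neg_add]

lemma monicSol_subset_sub_one (k : ℝ) : monicSol k ⊆ monicSol (k - 1) := fun f hf ↦ by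
  simpa using mul_mem_monicSol_of_const (y := 1) (c := 0) (by simp) hf

lemma logQ_mdifferentiable : MDiff logQ :=
  mdifferentiable_const.mul mdifferentiable_coe

lemma holoDeriv_logQ : holoDeriv (.mk logQ logQ_mdifferentiable) = algebraMap ℂ HoloFun 1 := by
  rw [map_one]
  apply val_injective
  ext z
  rw [val_holoDeriv, val_mk, map_one, normalizedDerivOfComplex]
  have h : HasDerivAt (logQ ∘ ofComplex) (2 * (Real.pi : ℂ) * Complex.I * 1) (z : ℂ) := by
    refine ((hasDerivAt_id (z : ℂ)).const_mul _).congr_of_eventuallyEq ?_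
    filter_upwards [isOpen_upperHalfPlaneSet.mem_nhds z.im_pos] with v hv
    simp [logQ, ofComplex_apply_of_im_pos hv]
  rw [h.deriv, mul_one, inv_mul_cancel₀ (by simp [Real.pi_ne_zero])]
  rfl

lemma E2_mul_mem_monicSol {k : ℝ} {f : ℍ → ℂ} (hf : f ∈ monicSol k) :
    E2 * f ∈ monicSol (k + 1) := by
  obtain ⟨F, rfl⟩ := exists_holoFun_of_mem_monicSol hf
  have h := (isFiniteUnder_of_const (y := algebraMap ℂ HoloFun 12) (c := 0) (by simp)).2.mul
    (mem_monicSol_iff.mp hf)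
  -- D₋₁(12) = E₂ sits in degree 1, so the product has twist k − 1 but its single factor X raises
  -- the weight by 2, to k + 1.
  have h1 : twistedDeriv gradedSerre gradedE2 (-1) (C (algebraMap ℂ HoloFun 12)) * C F =
      monomial 1 (holoE2 * F) := by
    rw [← monomial_zero_left, twistedDeriv_monomial, ← monomial_zero_left, monomial_mul_monomial]
    rw [show (0 + 1 + 0 : ℕ) = 1 from rfl]
    congr 1
    apply val_injective
    ext z
    simp [holoSerre]
    ring
  rw [h1] at h
  have h2 := satisfiesMonicMLDE_of_isFiniteUnder (k := k + 1) (by push_cast; ring) h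
  rw [map_mul] at h2
  exact ⟨E2_mdifferentiable.mul F.mdiff, h2⟩

lemma monicSol_subset_sub_nat (k : ℝ) (n : ℕ) : monicSol k ⊆ monicSol (k - n) := by
  induction n with
  | zero => simp
  | succ n ih =>
    refine ih.trans ((monicSol_subset_sub_one _).trans_eq ?_)
    push_cast
    rw [sub_sub]

lemma add_mem_monicSol {k : ℝ} {f g : ℍ → ℂ} (hf : f ∈ monicSol k) (hg : g ∈ monicSol k) :
    f + g ∈ monicSol k := by
  obtain ⟨F, rfl⟩ := exists_holoFun_of_mem_monicSol hf
  obtain ⟨G, rfl⟩ := exists_holoFun_of_mem_monicSol hg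
  rw [← map_add, mem_monicSol_iff, C_add]
  exact (mem_monicSol_iff.mp hf).add (mem_monicSol_iff.mp hg)

lemma monicSol_subset_of_le {k l : ℝ} (hkl : l ≤ k) {m : ℤ} (hm : k - l = m) :
    monicSol k ⊆ monicSol l := by
  have h0 : 0 ≤ m := by
    have : (0 : ℝ) ≤ m := by linarith
    exact_mod_cast this
  lift m to ℕ using h0
  have : l = k - m := by
    push_cast at hm
    linarith
  exact this ▸ monicSol_subset_sub_nat k m

end MonicMLDE

theorem mainTheorem7 :
    (∀ k : ℝ, monicSol k ⊆ monicSol (k - 1)) ∧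
    (∀ k : ℝ, (fun f : ℍ → ℂ => logQ * f) '' monicSol k ⊆ monicSol (k - 1)) ∧
    (∀ k : ℝ, (fun f : ℍ → ℂ => EisensteinSeries.E2 * f) '' monicSol k ⊆ monicSol (k + 1)) ∧
    (∀ k l : ℝ, (∃ m : ℤ, k - l = (m : ℝ)) →
      monicSol k + monicSol l ⊆ monicSol (min k l)) := by
  refine ⟨monicSol_subset_sub_one, ?_, ?_, ?_⟩
  · rintro k _ ⟨f, hf, rfl⟩
    exact mul_mem_monicSol_of_const holoDeriv_logQ hf
  · rintro k _ ⟨f, hf, rfl⟩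
    exact E2_mul_mem_monicSol hf
  · rintro k l ⟨m, hm⟩ _ ⟨f, hf, g, hg, rfl⟩
    rcases le_total k l with h | h
    · rw [min_eq_left h]
      exact add_mem_monicSol hf (monicSol_subset_of_le (m := -m) h (by push_cast; linarith) hg)
    · rw [min_eq_right h]
      exact add_mem_monicSol (monicSol_subset_of_le h hm hf) hg
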